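/- Let $K$ be a field, $X$ a set of indeterminates, $A=K[X]$, and let $m_1,\dots,m_s$ be an $M$-sequence of monomials in $X$, i.e. for every $1\le i\le s$ there is a total order $x_1\prec\dots\prec x_n$ on the set of indeterminates dividing $m_i$, with $m_i=x_1^{e_1}\cdots x_n^{e_n}$ and all $e_r>0$, such that whenever $i<j\le s$ and $x_k\mid m_j$ for some $1\le k\le n$, then $x_k^{e_k}x_{k+1}^{e_{k+1}}\cdots x_n^{e_n}\mid m_j$. Put $I=\langle m_1,\dots,m_s\rangle$ and $I_i=\langle m_1,\dots,m_i\rangle$ (so $I_0=0$). Then the following are equivalent. 1. $m_1,\dots,m_s$ is a $c$-sequence in $A$, i.e. $(I_{i-1}I^k:m_i)\cap I^k=I_{i-1}I^{k-1}$ for all $1\le i\le s$ and all $k\ge 1$. 2. For all $1\le j\le s-1$ and all $1\le k<j$ there is some $1\le l<j+1$ such that $m_l\cdot\gcd(m_k,m_j)$ divides $m_k\cdot\gcd(m_l,m_{j+1})$. 3. The successive colon ideals are increasing: $(I_{j-1}:m_j)\subseteq(I_j:m_{j+1})$ for all $1\le j\le s-1$. -/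

import Mathlib

/-- The ideal `⟨a_1, …, a_{i-1}⟩` generated by the terms of the sequence strictly before `a_i`
(the zero ideal when `a_i` is the first term). -/
def prevIdeal {A : Type*} [CommRing A] {s : ℕ} (a : Fin s → A) (i : Fin s) : Ideal A :=
  Ideal.span (a '' Set.Iio i)

/-- A sequence `a_1, …, a_s` in a commutative ring `A`, with `I = ⟨a_1, …, a_s⟩` and
`I_{i-1} = ⟨a_1, …, a_{i-1}⟩`, is a `c`-sequence if
`(I_{i-1} I^k : a_i) ∩ I^k = I_{i-1} I^{k-1}` for all `i` and all `k ≥ 1`. -/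
def IsCSequence {A : Type*} [CommRing A] {s : ℕ} (a : Fin s → A) : Prop :=
  ∀ (i : Fin s) (k : ℕ), 1 ≤ k →
    (prevIdeal a i * Ideal.span (Set.range a) ^ k).colon {a i} ⊓ Ideal.span (Set.range a) ^ k
      = prevIdeal a i * Ideal.span (Set.range a) ^ (k - 1)

/-- `m_1, …, m_s` is an `M`-sequence of monomials in the indeterminates `σ`: for every `i` there is
an ordering `x_1 ≺ ⋯ ≺ x_n` of the indeterminates occurring in `m_i`, with
`m_i = x_1^{e_1} ⋯ x_n^{e_n}` and all `e_k > 0`, such that whenever `i < j` and `x_k ∣ m_j`, then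
`x_k^{e_k} ⋯ x_n^{e_n} ∣ m_j`. The monomial `1` is allowed (`n = 0`). -/
def IsMSequence {σ K : Type*} [Field K] {s : ℕ} (m : Fin s → MvPolynomial σ K) : Prop :=
  ∀ i : Fin s, ∃ (n : ℕ) (x : Fin n ↪ σ) (e : Fin n → ℕ),
    (∀ k, 0 < e k) ∧
    m i = ∏ k, MvPolynomial.X (x k) ^ e k ∧
    ∀ j : Fin s, i < j → ∀ k : Fin n, MvPolynomial.X (x k) ∣ m j →
      (∏ r ∈ Finset.Ici k, (MvPolynomial.X (x r) : MvPolynomial σ K) ^ e r) ∣ m j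

/-- The greatest common divisor in the unique factorization domain `K[σ]`
(determined up to a unit, which is irrelevant for divisibility). -/
noncomputable def polyGCD {σ K : Type*} [Field K] (p q : MvPolynomial σ K) : MvPolynomial σ K :=
  (UniqueFactorizationMonoid.toGCDMonoid (MvPolynomial σ K)).gcd p q

open MvPolynomial

/-! In exponents, 2 and 3 are the same condition: for `k < j` some `l < j + 1` has `d l ≤ (d k - d
j) + d (j + 1)`. The case `k = 1` of 1 gives 3 in any commutative ring (`IsCSequence.colon_le`). For
3 ⇒ 1, let `v` be an exponent divisible by a product of terms `t`, with `d b ≤ v + d i` and `b < i`;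
some factor in `t` must be exchanged for a term before `i`. The chain property of an `M`-sequence
lets one term of `t`, or `d i`, absorb the variables of `d b`. In the latter case the iterated colon
condition transfers the exchange from `i` to a factor in `t` (`exists_add_sum_le`). -/

/-- Properties of the exponent vectors of an `M`-sequence: a variable
of `d i` that occurs in a later `d j` occurs there with at least the same exponent, and the sets of
variables of `d i` occurring in later terms form a chain. -/
structure IsMExponents {σ : Type*} {s : ℕ} (d : Fin s → σ →₀ ℕ) : Prop where
  eq_zero_or_le : ∀ {i j : Fin s}, i < j → ∀ x, d j x = 0 ∨ d i x ≤ d j x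
  total : ∀ {i a b : Fin s}, i < a → i < b →
    (∀ x, d i x ≠ 0 → d a x ≠ 0 → d b x ≠ 0) ∨ (∀ x, d i x ≠ 0 → d b x ≠ 0 → d a x ≠ 0)

theorem IsMSequence.exists_exponents {σ K : Type*} [Field K] {s : ℕ}
    {m : Fin s → MvPolynomial σ K} (hm : IsMSequence m) :
    ∃ d : Fin s → σ →₀ ℕ, IsMExponents d ∧ m = fun i => monomial (d i) 1 := by
  classical
  choose n x e hpos hprod hdiv using hm
  have hX : ∀ i (S : Finset (Fin (n i))),
      ∏ k ∈ S, (X (x i k) : MvPolynomial σ K) ^ e i k =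
        monomial (∑ k ∈ S, Finsupp.single (x i k) (e i k)) 1 := fun i S => by
    rw [monomial_sum_one]
    exact Finset.prod_congr rfl fun k _ => X_pow_eq_monomial
  set d : Fin s → σ →₀ ℕ := fun i => ∑ k, Finsupp.single (x i k) (e i k) with hd
  have hmd : m = fun i => monomial (d i) 1 := funext fun i => by rw [hprod i, hX]
  have hsum : ∀ i (S : Finset (Fin (n i))) r, r ∈ S →
      (∑ k ∈ S, Finsupp.single (x i k) (e i k)) (x i r) = e i r := fun i S r hr => by
    rw [Finsupp.finsetSum_apply, Finset.sum_eq_single_of_mem r hr, Finsupp.single_eq_same]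
    intro k _ hk
    exact Finsupp.single_eq_of_ne fun h => hk ((x i).injective h.symm)
  have hsupp : ∀ i y, d i y ≠ 0 → ∃ k, y = x i k := fun i y hy => by
    by_contra! h
    refine hy ?_
    rw [hd, Finsupp.finsetSum_apply]
    exact Finset.sum_eq_zero fun k _ => Finsupp.single_eq_of_ne (h k)
  have hle : ∀ i j, i < j → ∀ k r : Fin (n i), k ≤ r → d j (x i k) ≠ 0 →
      e i r ≤ d j (x i r) := fun i j hij k r hkr hk => by
    have h := hdiv i j hij k (by rw [hmd]; simpa using hk)
    rw [hX, hmd, monomial_one_dvd_monomial_one] at h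
    have := h (x i r)
    rwa [hsum i _ r (Finset.mem_Ici.2 hkr)] at this
  refine ⟨d, ⟨fun {i j} hij y => ?_, fun {i a b} ha hb => ?_⟩, hmd⟩
  · rw [or_iff_not_imp_left]
    intro hj
    by_cases hi : d i y = 0
    · omega
    obtain ⟨k, rfl⟩ := hsupp i y hi
    have h := hle i j hij k k le_rfl hj
    rwa [hd, hsum i _ k (Finset.mem_univ _)]
  · by_contra! h
    obtain ⟨⟨y, hy, hya, hyb⟩, z, hz, hzb, hza⟩ := h
    obtain ⟨k, rfl⟩ := hsupp i y hy
    obtain ⟨r, rfl⟩ := hsupp i z hz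
    -- An occurrence of the `≺`-smaller of the two variables forces the larger one to occur.
    rcases le_total k r with hkr | hkr
    · have := hle i a ha k r hkr hya
      have := hpos i r
      omega
    · have := hle i b hb r k hkr hzb
      have := hpos i k
      omega

/-! ### Monomial ideals in terms of exponents -/

section MonomialIdeals

variable {σ K : Type*} [Field K] {s : ℕ} (d : Fin s → σ →₀ ℕ)

theorem prevIdeal_monomial (i : Fin s) :
    prevIdeal (fun i => (monomial (d i) 1 : MvPolynomial σ K)) i =
      Ideal.span ((fun u => monomial u 1) '' {u | ∃ b < i, u = d b}) := by
  rw [prevIdeal]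
  congr 1
  ext p
  simp [eq_comm]

theorem span_range_monomial_pow (k : ℕ) :
    Ideal.span (Set.range fun i => (monomial (d i) 1 : MvPolynomial σ K)) ^ k =
      Ideal.span ((fun u => monomial u 1) ''
        {u | ∃ t : Multiset (Fin s), t.card = k ∧ u = (t.map d).sum}) := by
  induction k with
  | zero =>
    rw [pow_zero, Ideal.one_eq_top, eq_comm, Ideal.eq_top_iff_one]
    exact Ideal.subset_span ⟨0, ⟨0, rfl, by simp⟩, rfl⟩
  | succ k ih =>
    rw [pow_succ, ih, Ideal.span_mul_span']
    congr 1
    ext p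
    simp only [Set.mem_mul, Set.mem_image, Set.mem_ofPred_eq, Set.mem_range]
    constructor
    · rintro ⟨_, ⟨_, ⟨t, ht, rfl⟩, rfl⟩, _, ⟨i, rfl⟩, rfl⟩
      exact ⟨_, ⟨i ::ₘ t, by simp [ht], rfl⟩, by simp [monomial_mul, add_comm]⟩
    · rintro ⟨_, ⟨t, ht, rfl⟩, rfl⟩
      obtain ⟨i, hi⟩ := Multiset.card_pos_iff_exists_mem.1 (by omega : 0 < t.card)
      obtain ⟨t, rfl⟩ := Multiset.exists_cons_of_mem hi
      exact ⟨_, ⟨_, ⟨t, by simpa using ht, rfl⟩, rfl⟩, _, ⟨i, rfl⟩,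
        by simp [monomial_mul, add_comm]⟩

theorem prevIdeal_mul_pow_monomial (i : Fin s) (k : ℕ) :
    prevIdeal (fun i => (monomial (d i) 1 : MvPolynomial σ K)) i *
        Ideal.span (Set.range fun i => (monomial (d i) 1 : MvPolynomial σ K)) ^ k =
      Ideal.span ((fun u => monomial u 1) ''
        {u | ∃ b < i, ∃ t : Multiset (Fin s), t.card = k ∧ u = d b + (t.map d).sum}) := by
  rw [prevIdeal_monomial, span_range_monomial_pow, Ideal.span_mul_span']
  congr 1
  ext p
  simp only [Set.mem_mul, Set.mem_image, Set.mem_ofPred_eq]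
  constructor
  · rintro ⟨_, ⟨_, ⟨b, hb, rfl⟩, rfl⟩, _, ⟨_, ⟨t, ht, rfl⟩, rfl⟩, rfl⟩
    exact ⟨_, ⟨b, hb, t, ht, rfl⟩, by simp [monomial_mul]⟩
  · rintro ⟨_, ⟨b, hb, t, ht, rfl⟩, rfl⟩
    exact ⟨_, ⟨_, ⟨b, hb, rfl⟩, rfl⟩, _, ⟨_, ⟨t, ht, rfl⟩, rfl⟩, by simp [monomial_mul]⟩

end MonomialIdeals

theorem mem_colon_span_monomial_image {σ K : Type*} [Field K] {S : Set (σ →₀ ℕ)} {e : σ →₀ ℕ}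
    {f : MvPolynomial σ K} :
    f ∈ (Ideal.span ((fun u => (monomial u 1 : MvPolynomial σ K)) '' S)).colon {monomial e 1} ↔
      ∀ v ∈ f.support, ∃ u ∈ S, u ≤ v + e := by
  rw [Submodule.mem_colon_singleton, smul_eq_mul, mem_ideal_span_monomial_image]
  constructor
  · intro h v hv
    refine h (v + e) ?_
    rw [mem_support_iff, coeff_mul_monomial, mul_one]
    exact mem_support_iff.1 hv
  · intro h w hw
    rw [mem_support_iff, coeff_mul_monomial', mul_one] at hw
    split_ifs at hw with hle
    · obtain ⟨u, hu, huw⟩ := h (w - e) (mem_support_iff.2 hw)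
      exact ⟨u, hu, by rwa [tsub_add_cancel_of_le hle] at huw⟩
    · exact absurd rfl hw

/-- An inclusion of ideals given by conditions on exponents can be tested on monomials. -/
theorem le_iff_of_mem_iff_support {σ K : Type*} [Field K] {I J : Ideal (MvPolynomial σ K)}
    {P Q : (σ →₀ ℕ) → Prop} (hI : ∀ f, f ∈ I ↔ ∀ v ∈ f.support, P v)
    (hJ : ∀ f, f ∈ J ↔ ∀ v ∈ f.support, Q v) : I ≤ J ↔ ∀ v, P v → Q v := by
  classical
  constructor
  · intro h v hv
    have hmem : monomial v 1 ∈ I := (hI _).2 fun w hw => by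
      rw [support_monomial, if_neg one_ne_zero, Finset.mem_singleton] at hw
      rwa [hw]
    exact (hJ _).1 (h hmem) v (by simp)
  · intro h f hf
    exact (hJ f).2 fun v hv => h v ((hI f).1 hf v hv)

/-- The left colon ideal is generated by the monomials with exponents `d k - d j`, `k < j`, so these
suffice as tests. -/
theorem colon_prevIdeal_monomial_le_iff {σ K : Type*} [Field K] {s : ℕ} (d : Fin s → σ →₀ ℕ)
    (j t : Fin s) :
    (prevIdeal (fun i => (monomial (d i) 1 : MvPolynomial σ K)) j).colon {monomial (d j) 1} ≤
        (prevIdeal (fun i => (monomial (d i) 1 : MvPolynomial σ K)) t).colon {monomial (d t) 1} ↔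
      ∀ k < j, ∃ l < t, d l ≤ (d k - d j) + d t := by
  simp_rw [prevIdeal_monomial]
  rw [le_iff_of_mem_iff_support (fun _ => mem_colon_span_monomial_image)
    (fun _ => mem_colon_span_monomial_image)]
  constructor
  · intro h k hk
    obtain ⟨_, ⟨l, hl, rfl⟩, hle⟩ := h (d k - d j) ⟨_, ⟨k, hk, rfl⟩, le_tsub_add⟩
    exact ⟨l, hl, hle⟩
  · rintro h v ⟨_, ⟨k, hk, rfl⟩, hle⟩
    obtain ⟨l, hl, hle'⟩ := h k hk
    exact ⟨_, ⟨l, hl, rfl⟩, hle'.trans (by gcongr; exact tsub_le_iff_right.2 hle)⟩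

theorem associated_polyGCD_monomial {σ K : Type*} [Field K] (u v : σ →₀ ℕ) :
    Associated (polyGCD (monomial u 1 : MvPolynomial σ K) (monomial v 1))
      (monomial (u ⊓ v) 1) := by
  let := UniqueFactorizationMonoid.toGCDMonoid (MvPolynomial σ K)
  have hu : polyGCD (monomial u 1 : MvPolynomial σ K) (monomial v 1) ∣ monomial u 1 :=
    GCDMonoid.gcd_dvd_left _ _
  have hv : polyGCD (monomial u 1 : MvPolynomial σ K) (monomial v 1) ∣ monomial v 1 :=
    GCDMonoid.gcd_dvd_right _ _
  refine associated_of_dvd_dvd ?_ (GCDMonoid.dvd_gcd ?_ ?_)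
  · obtain ⟨w, c, hwu, -, h⟩ := dvd_monomial_one_iff_exists.1 hu
    rw [h, monomial_dvd_monomial] at hv ⊢
    exact ⟨Or.inr (le_inf hwu (hv.1.resolve_left one_ne_zero)), hv.2⟩
  · exact monomial_one_dvd_monomial_one.2 inf_le_left
  · exact monomial_one_dvd_monomial_one.2 inf_le_right

/-- Since `k - k ⊓ j = k - j`, divisibility reads `l ≤ (k - j) + l ⊓ t`, and the bound by `l` is
automatic. -/
theorem monomial_mul_polyGCD_dvd_iff {σ K : Type*} [Field K] (l k j t : σ →₀ ℕ) :
    (monomial l 1 : MvPolynomial σ K) * polyGCD (monomial k 1) (monomial j 1) ∣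
        monomial k 1 * polyGCD (monomial l 1) (monomial t 1) ↔ l ≤ (k - j) + t := by
  rw [((associated_polyGCD_monomial k j).mul_left _).dvd_iff_dvd_left,
    ((associated_polyGCD_monomial l t).mul_left _).dvd_iff_dvd_right, monomial_mul, monomial_mul,
    mul_one, monomial_one_dvd_monomial_one, Finsupp.le_def, Finsupp.le_def]
  refine forall_congr' fun x => ?_
  simp only [Finsupp.add_apply, Finsupp.inf_apply, Finsupp.tsub_apply]
  omega

theorem isCSequence_monomial_iff {σ K : Type*} [Field K] {s : ℕ} (d : Fin s → σ →₀ ℕ) :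
    IsCSequence (fun i => (monomial (d i) 1 : MvPolynomial σ K)) ↔
      ∀ (i : Fin s) (k : ℕ), 1 ≤ k → ∀ v : σ →₀ ℕ,
        (∃ b < i, ∃ t : Multiset (Fin s), t.card = k ∧ d b + (t.map d).sum ≤ v + d i) →
        (∃ t : Multiset (Fin s), t.card = k ∧ (t.map d).sum ≤ v) →
        ∃ b < i, ∃ t : Multiset (Fin s), t.card = k - 1 ∧ d b + (t.map d).sum ≤ v := by
  refine forall_congr' fun i => forall_congr' fun k => forall_congr' fun hk => ?_
  -- This inclusion holds for every sequence, so only the reverse one carries content.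
  have hge : prevIdeal (fun i => (monomial (d i) 1 : MvPolynomial σ K)) i *
        Ideal.span (Set.range fun i => (monomial (d i) 1 : MvPolynomial σ K)) ^ (k - 1) ≤
      (prevIdeal (fun i => (monomial (d i) 1 : MvPolynomial σ K)) i *
        Ideal.span (Set.range fun i => (monomial (d i) 1 : MvPolynomial σ K)) ^ k).colon
          {monomial (d i) 1} ⊓
        Ideal.span (Set.range fun i => (monomial (d i) 1 : MvPolynomial σ K)) ^ k := by
    obtain ⟨k, rfl⟩ := Nat.exists_eq_add_of_le' hk
    rw [Nat.add_sub_cancel]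
    refine le_inf (fun f hf => ?_) ?_
    · rw [Submodule.mem_colon_singleton, smul_eq_mul, pow_succ, ← mul_assoc]
      exact Ideal.mul_mem_mul hf (Ideal.subset_span ⟨i, rfl⟩)
    · rw [pow_succ, mul_comm]
      exact Ideal.mul_mono_right (Ideal.span_mono (Set.image_subset_range _ _))
  rw [← hge.ge_iff_eq', prevIdeal_mul_pow_monomial, prevIdeal_mul_pow_monomial,
    span_range_monomial_pow, le_iff_of_mem_iff_support
      (P := fun v => (∃ b < i, ∃ t : Multiset (Fin s), t.card = k ∧
        d b + (t.map d).sum ≤ v + d i) ∧ ∃ t : Multiset (Fin s), t.card = k ∧ (t.map d).sum ≤ v)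
      (Q := fun v => ∃ b < i, ∃ t : Multiset (Fin s), t.card = k - 1 ∧ d b + (t.map d).sum ≤ v)]
  · simp only [and_imp]
  · intro f
    rw [Submodule.mem_inf, mem_colon_span_monomial_image, mem_ideal_span_monomial_image,
      ← forall₂_and]
    refine forall₂_congr fun v _ => and_congr ?_ ?_
    · constructor
      · rintro ⟨_, ⟨b, hb, t, ht, rfl⟩, h⟩
        exact ⟨b, hb, t, ht, h⟩
      · rintro ⟨b, hb, t, ht, h⟩
        exact ⟨_, ⟨b, hb, t, ht, rfl⟩, h⟩
    · constructor
      · rintro ⟨_, ⟨t, ht, rfl⟩, h⟩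
        exact ⟨t, ht, h⟩
      · rintro ⟨t, ht, h⟩
        exact ⟨_, ⟨t, ht, rfl⟩, h⟩
  · intro f
    rw [mem_ideal_span_monomial_image]
    refine forall₂_congr fun v _ => ?_
    constructor
    · rintro ⟨_, ⟨b, hb, t, ht, rfl⟩, h⟩
      exact ⟨b, hb, t, ht, h⟩
    · rintro ⟨b, hb, t, ht, h⟩
      exact ⟨_, ⟨b, hb, t, ht, rfl⟩, h⟩

/-- The terms of a `c`-sequence have increasing successive colon ideals. -/
theorem IsCSequence.colon_le {A : Type*} [CommRing A] {s : ℕ} {a : Fin s → A}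
    (ha : IsCSequence a) {j t : Fin s} (hjt : j ≤ t) :
    (prevIdeal a j).colon {a j} ≤ (prevIdeal a t).colon {a t} := by
  intro u hu
  rw [Submodule.mem_colon_singleton, smul_eq_mul] at hu ⊢
  have hspan : ∀ i, a i ∈ Ideal.span (Set.range a) := fun i => Ideal.subset_span ⟨i, rfl⟩
  -- Case `k = 1`: `u * a t` lies in `I`, and multiplying it by `a j` lands in `prevIdeal a j * I`.
  have hmem : u * a t ∈ prevIdeal a j := by
    have h := ha j 1 le_rfl
    rw [Nat.sub_self, pow_zero, mul_one, pow_one] at h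
    rw [← h]
    refine ⟨?_, Ideal.mul_mem_left _ _ (hspan t)⟩
    rw [SetLike.mem_coe, Submodule.mem_colon_singleton, smul_eq_mul, mul_right_comm]
    exact Ideal.mul_mem_mul hu (hspan t)
  exact Ideal.span_mono (Set.image_mono (Set.Iio_subset_Iio hjt)) hmem

/-! ### Exchange arguments on exponent vectors -/

namespace IsMExponents

variable {σ : Type*} {s : ℕ} {d : Fin s → σ →₀ ℕ}

/-- Among finitely many terms after `d i` one contains all the variables of `d i` that occur in
any of them. -/
theorem exists_forall_ne_zero (hd : IsMExponents d) {i : Fin s} (t : Multiset (Fin s)) (a : Fin s)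
    (ht : ∀ r ∈ a ::ₘ t, i < r) :
    ∃ r ∈ a ::ₘ t, ∀ r' ∈ a ::ₘ t, ∀ x, d i x ≠ 0 → d r' x ≠ 0 → d r x ≠ 0 := by
  induction t using Multiset.induction_on with
  | empty => exact ⟨a, by simp, by simp⟩
  | cons c t ih =>
    rw [Multiset.cons_swap] at ht ⊢
    obtain ⟨hc, ht⟩ := Multiset.forall_mem_cons.1 ht
    obtain ⟨r, hr, h⟩ := ih ht
    rcases hd.total hc (ht r hr) with hcr | hrc
    · exact ⟨r, Multiset.mem_cons_of_mem hr, Multiset.forall_mem_cons.2 ⟨hcr, h⟩⟩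
    · exact ⟨c, Multiset.mem_cons_self _ _, Multiset.forall_mem_cons.2
        ⟨fun _ _ hx => hx, fun r' hr' x hx hx' => hrc x hx (h r' hr' x hx hx')⟩⟩

/-- Chaining the consecutive conditions only bounds `l` by `t`; inducting on `t - j` with `j`
varying keeps `l < j`, which the exchange before `i` needs. -/
theorem exists_le_add_of_le (hd : IsMExponents d)
    (h : ∀ j j' : Fin s, (j' : ℕ) = (j : ℕ) + 1 → ∀ k < j, ∃ l < j', d l ≤ (d k - d j) + d j')
    {j t : Fin s} (hjt : j ≤ t) {k : Fin s} (hk : k < j) :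
    ∃ l < j, d l ≤ (d k - d j) + d t := by
  obtain ⟨n, hn⟩ := Nat.exists_eq_add_of_le (Fin.le_def.1 hjt)
  clear hjt
  induction n generalizing j k with
  | zero =>
    obtain rfl : t = j := Fin.ext hn
    exact ⟨k, hk, le_tsub_add⟩
  | succ n ih =>
    let j' : Fin s := ⟨j + 1, by omega⟩
    obtain ⟨l, hl, hle⟩ := h j j' rfl k hk
    obtain ⟨l', hl', hle'⟩ := ih hl (show (t : ℕ) = j + 1 + n by omega)
    have hle₂ : d l' ≤ (d k - d j) + d t :=
      hle'.trans (add_le_add (tsub_le_iff_right.2 hle) le_rfl)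
    rcases (show l' ≤ j from Nat.lt_succ_iff.1 hl').lt_or_eq with hlt | rfl
    · exact ⟨l', hlt, hle₂⟩
    -- If the witness is `j` itself, `k` replaces it: where `d j x ≠ 0`, `d k x ≤ d j x`.
    · refine ⟨k, hk, fun x => ?_⟩
      have h₁ := hle₂ x
      have h₂ := hd.eq_zero_or_le hk x
      simp only [Finsupp.add_apply, Finsupp.tsub_apply] at h₁ ⊢
      omega

theorem exists_add_sum_le (hd : IsMExponents d)
    (h : ∀ j j' : Fin s, (j' : ℕ) = (j : ℕ) + 1 → ∀ k < j, ∃ l < j', d l ≤ (d k - d j) + d j')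
    {i b : Fin s} (hb : b < i) {v : σ →₀ ℕ} (hv : d b ≤ v + d i) {t : Multiset (Fin s)}
    (ht0 : t ≠ 0) (ht : (t.map d).sum ≤ v) :
    ∃ l < i, ∃ a ∈ t, d l + ((t.erase a).map d).sum ≤ v := by
  have herase : ∀ a ∈ t, d a + ((t.erase a).map d).sum = (t.map d).sum :=
    fun a ha => Multiset.sum_map_erase ha
  by_cases hlt : ∃ a ∈ t, a < i
  · obtain ⟨a, ha, hai⟩ := hlt
    exact ⟨a, hai, a, ha, (herase a ha).trans_le ht⟩
  push Not at hlt
  obtain ⟨f, rfl⟩ := exists_add_of_le ht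
  have key : ∀ l < i, ∀ a ∈ t, d l ≤ f + d a →
      ∃ l < i, ∃ a ∈ t, d l + ((t.erase a).map d).sum ≤ (t.map d).sum + f := by
    intro l hl a ha hle
    refine ⟨l, hl, a, ha, (add_le_add_left hle _).trans_eq ?_⟩
    rw [add_assoc, herase a ha, add_comm]
  obtain ⟨r, hr, hmax⟩ := hd.exists_forall_ne_zero (i := b) t i
    (Multiset.forall_mem_cons.2 ⟨hb, fun a ha => hb.trans_le (hlt a ha)⟩)
  have hbr : b < r := by
    rcases Multiset.mem_cons.1 hr with rfl | hr
    exacts [hb, hb.trans_le (hlt r hr)]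
  have hle : d b ≤ f + d r := by
    intro x
    rw [Finsupp.add_apply]
    by_cases hbx : d b x = 0
    · omega
    -- If `x` is missing from `d r`, maximality removes it from `d i` and all of `t`, so `f` alone
    -- supplies `d b x`.
    rcases hd.eq_zero_or_le hbr x with hrx | hrx
    · have hzero : ∀ a ∈ i ::ₘ t, d a x = 0 := fun a ha => by
        by_contra hax
        exact hmax a ha x hbx hax hrx
      have hsum : (t.map d).sum x = 0 := by
        rw [← Finsupp.applyAddHom_apply, map_multiset_sum, Multiset.map_map]
        refine Multiset.sum_eq_zero fun y hy => ?_
        obtain ⟨a, ha, rfl⟩ := Multiset.mem_map.1 hy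
        exact hzero a (Multiset.mem_cons_of_mem ha)
      have hix := hzero i (Multiset.mem_cons_self _ _)
      have := hv x
      simp only [Finsupp.add_apply] at this
      omega
    · omega
  rcases Multiset.mem_cons.1 hr with rfl | hr
  · obtain ⟨a, ha⟩ := Multiset.exists_mem_of_ne_zero ht0
    obtain ⟨l, hl, hla⟩ := hd.exists_le_add_of_le h (hlt a ha) hb
    exact key l hl a ha (hla.trans (by gcongr; exact tsub_le_iff_right.2 hle))
  · exact key b hb r hr hle

end IsMExponents

theorem mainTheorem3 {σ K : Type*} [Field K] {s : ℕ} (m : Fin s → MvPolynomial σ K)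
    (hm : IsMSequence m) :
    (IsCSequence m ↔
      ∀ j j' : Fin s, (j' : ℕ) = (j : ℕ) + 1 → ∀ k : Fin s, k < j →
        ∃ l : Fin s, l < j' ∧ m l * polyGCD (m k) (m j) ∣ m k * polyGCD (m l) (m j')) ∧
    (IsCSequence m ↔
      ∀ j j' : Fin s, (j' : ℕ) = (j : ℕ) + 1 →
        (prevIdeal m j).colon {m j} ≤ (prevIdeal m j').colon {m j'}) := by
  obtain ⟨d, hd, hmd⟩ := hm.exists_exponents
  have hcolon : IsCSequence m → ∀ j j' : Fin s, (j' : ℕ) = (j : ℕ) + 1 →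
      (prevIdeal m j).colon {m j} ≤ (prevIdeal m j').colon {m j'} :=
    fun hc j j' hj => hc.colon_le (Fin.le_def.2 (by omega))
  subst hmd
  simp_rw [monomial_mul_polyGCD_dvd_iff, colon_prevIdeal_monomial_le_iff] at hcolon ⊢
  rw [and_self]
  refine ⟨hcolon, fun h => (isCSequence_monomial_iff d).2 ?_⟩
  rintro i k hk v ⟨b, hb, t', -, hbt⟩ ⟨t, rfl, ht⟩
  -- The factor `t'` from `I ^ k` in the colon is discarded; `d b ≤ v + d i` is enough.
  obtain ⟨l, hl, a, ha, hle⟩ := hd.exists_add_sum_le h hb (le_self_add.trans hbt)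
    (Multiset.card_pos.1 hk) ht
  exact ⟨l, hl, t.erase a, Multiset.card_erase_of_mem ha, hle⟩
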